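/- Let $G$ be a (finite-dimensional, real) Lie group with identity $1$ and Lie algebra $\mathfrak g=T_1G$, and let $\|\cdot\|$ be a polyhedral norm on $\mathfrak g$, i.e. a norm whose closed unit ball is the convex hull of finitely many points; thus $(G,\mathfrak g,\|\cdot\|)$ is a Finsler Lie group with polyhedral norm. Denote by $E(v)=\tfrac12\|v\|^2$ the energy of the norm and by $\partial_vE=\{\eta\in\mathfrak g^*:\eta(w-v)\le E(w)-E(v)\ \ \forall w\in\mathfrak g\}$ its subdifferential at $v\in\mathfrak g$. For an interval $I\subseteq\mathbb R$, an absolutely continuous curve $\gamma:I\to G$ whose control $u(t)=(\mathrm dL_{\gamma(t)})^{-1}\dot\gamma(t)$ belongs to $L^2(I,\mathfrak g)$ is called normal if there is $\lambda\in\mathfrak g^*$ such that $\lambda\circ\mathrm{Ad}_{\gamma(t)}\in\partial_{u(t)}E$ for almost every $t\in I$; its length is $\int_I\|u(t)\|\,\mathrm dt$. Then there exists $L>0$ such that for every interval $I\subseteq\mathbb R$ and every normal curve $\gamma:I\to G$ with length in $(0,L)$, the control $u$ of $\gamma$ takes values in a face: there are $r>0$ and a nonzero $\eta\in\mathfrak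 g^*$ such that, for almost every $t\in I$, $u(t)$ belongs to the face $$\Big\{v\in\mathfrak g:\ \|v\|\le r,\ \eta(v)=\max_{\|w\|\le r}\eta(w)\Big\}$$ of the sphere of radius $r$. -/

import Mathlib

open Set MeasureTheory
open scoped Manifold ContDiff ENNReal

noncomputable section

namespace FinslerLie

/-! ### Convex geometry of a norm on a real vector space

A norm on `V` is a `Seminorm ℝ V` that vanishes only at `0`.
-/

section Norms

variable {V : Type*} [AddCommGroup V] [Module ℝ V]

/-- The seminorm `N` is a norm. -/
def IsNorm (N : Seminorm ℝ V) : Prop :=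
  ∀ v : V, N v = 0 → v = 0

/-- A norm is polyhedral if its closed unit ball is a polyhedron,
i.e. the convex hull of finitely many points. -/
def IsPolyhedral (N : Seminorm ℝ V) : Prop :=
  ∃ s : Set V, s.Finite ∧ N.closedBall 0 1 = convexHull ℝ s

/-- The energy `E(v) = ‖v‖² / 2` of a norm. -/
def energy (N : Seminorm ℝ V) (v : V) : ℝ :=
  N v ^ 2 / 2

/-- The subdifferential of `f : V → ℝ` at `u`. (It is used for finite-dimensional `V`, where every
linear functional is continuous.) -/
def subdifferential (f : V → ℝ) (u : V) : Set (Module.Dual ℝ V) :=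
  {η | ∀ v : V, η (v - u) ≤ f v - f u}

/-- `F` is a face of the boundary of the compact convex set `K`: the set of maximizers on `K` of a
*nonzero* linear functional. (The zero functional would give `F = K`, which is not a subset of
the boundary.) -/
def IsFace (K F : Set V) : Prop :=
  ∃ η : Module.Dual ℝ V, η ≠ 0 ∧ F = {v ∈ K | ∀ w ∈ K, η w ≤ η v}

/-- The function `u : J → V` takes values in a face: there are `r > 0` and a face `F` of the sphere
of radius `r` such that `u t ∈ F` for almost every `t ∈ J`. -/
def TakesValuesInFace (N : Seminorm ℝ V) (J : Set ℝ) (u : ℝ → V) : Prop :=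
  ∃ r : ℝ, 0 < r ∧ ∃ F : Set V, IsFace (N.closedBall 0 r) F ∧
    ∀ᵐ t ∂(volume.restrict J), u t ∈ F

end Norms

/-! ### Curves in Lie groups

Here `G` is a Lie group modelled on `E`, and its Lie algebra is the tangent space at `1`.
A curve on an interval `J ⊆ ℝ` is given by a function `ℝ → G` whose values outside of `J` are
irrelevant.
-/

section Curves

variable {E : Type*} [NormedAddCommGroup E] [NormedSpace ℝ E]
  {G : Type*} [TopologicalSpace G] [ChartedSpace E G] [Group G]

variable (E) in
/-- The adjoint map `Ad_g : 𝔤 → 𝔤`, the differential at `1` of the conjugation `h ↦ g h g⁻¹`.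
(All tangent spaces are by definition copies of `E`, read in the preferred chart at the base point;
hence the tangent spaces at `g * 1 * g⁻¹` and at `1` are identified tautologically.) -/
def Ad (g : G) : GroupLieAlgebra 𝓘(ℝ, E) G →L[ℝ] GroupLieAlgebra 𝓘(ℝ, E) G :=
  (mfderiv 𝓘(ℝ, E) 𝓘(ℝ, E) (fun h : G => g * h * g⁻¹) (1 : G) : E →L[ℝ] E)

variable (E) in
/-- The curve `γ : J → G` is (locally) absolutely continuous: it is continuous, and absolutely
continuous in charts on each compact subinterval of `J` whose image is contained in the domain of
the chart. -/
def IsAbsolutelyContinuousCurve (J : Set ℝ) (γ : ℝ → G) : Prop :=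
  ContinuousOn γ J ∧
    ∀ a b : ℝ, a ≤ b → Icc a b ⊆ J → ∀ x : G, MapsTo γ (Icc a b) (chartAt E x).source →
      AbsolutelyContinuousOnInterval (fun t => chartAt E x (γ t)) a b

/-- The measurable function `u : J → 𝔤` is the control of the curve `γ`:
`γ' t = dL_{γ t} (u t)` for almost every `t ∈ J`. -/
def IsControl (J : Set ℝ) (γ : ℝ → G) (u : ℝ → GroupLieAlgebra 𝓘(ℝ, E) G) : Prop :=
  AEStronglyMeasurable u (volume.restrict J) ∧
    ∀ᵐ t ∂(volume.restrict J),
      HasMFDerivAt 𝓘(ℝ, ℝ) 𝓘(ℝ, E) γ t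
        ((1 : ℝ →L[ℝ] ℝ).smulRight (mulInvariantVectorField (u t) (γ t)))

/-- The length of a curve with control `u : J → 𝔤`. -/
def length (N : Seminorm ℝ (GroupLieAlgebra 𝓘(ℝ, E) G)) (J : Set ℝ)
    (u : ℝ → GroupLieAlgebra 𝓘(ℝ, E) G) : ℝ≥0∞ :=
  ∫⁻ t in J, ENNReal.ofReal (N (u t))

/-- In the Finsler Lie group `(G, 𝔤, N)`, the curve `γ : J → G` is a normal curve with control `u`:
`γ` is absolutely continuous, `u` is the control of `γ` and belongs to `L²(J, 𝔤)`, and there is a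
covector `l` with `l ∘ Ad_{γ t} ∈ ∂_{u t} E` for almost every `t ∈ J`. (The polarization is the
whole Lie algebra, hence every absolutely continuous curve is horizontal.) -/
structure IsNormalCurve (N : Seminorm ℝ (GroupLieAlgebra 𝓘(ℝ, E) G)) (J : Set ℝ) (γ : ℝ → G)
    (u : ℝ → GroupLieAlgebra 𝓘(ℝ, E) G) : Prop where
  absolutelyContinuous : IsAbsolutelyContinuousCurve E J γ
  isControl : IsControl J γ u
  sq_integrable : IntegrableOn (fun t => N (u t) ^ 2) J
  normal : ∃ l : Module.Dual ℝ (GroupLieAlgebra 𝓘(ℝ, E) G),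
    ∀ᵐ t ∂(volume.restrict J),
      l ∘ₗ (Ad E (γ t)).toLinearMap ∈ subdifferential (energy N) (u t)

end Curves

end FinslerLie

end

/-! Write `η t = λ ∘ Ad_{γ t}`. The control equation turns into `η' = η ∘ ad u`, and only `[u, u] =
0` is needed from the bracket. Let `h` be the support function of the unit ball, i.e. the dual norm.
Normality gives `h (η t) = N (u t)` and says that `u t / N (u t)` maximizes `η t` on the unit ball
when `u t ≠ 0`. The function `s ↦ h (η s) * N (u t) - η s (u t)` is nonnegative and vanishes at `s =
t`; since `η s (u t)` has derivative `η t [u t, u t] = 0` there, `h ∘ η` has derivative zero almost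
everywhere and is a constant `r` (`supportFunction_eq_of_absolutelyContinuous`). So `N (u t) = r`
almost everywhere. On a vertex `x` the value `η t x` varies by at most `r * C * length`
(`abs_apply_sub_le_setIntegral`). For a short curve, every vertex maximal for some `η t` is thus
almost maximal for one fixed `η t₀`. By compactness of the dual sphere, all vertices almost maximal
for a given functional lie in one face (`exists_pos_forall_exists_common_face`), which then contains
`u t / r`. -/

open Filter Topology

namespace FinslerLie

/-! ### Convex duality for a polyhedral norm. -/

section Convex

variable {V : Type*} [NormedAddCommGroup V] [NormedSpace ℝ V]

/-- Euler's identity for the 2-homogeneous energy: test the subgradient inequality along the ray `(1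
+ s) • v`, divide by `s`, and let `s → 0` from both sides. -/
theorem apply_self_of_mem_subdifferential_energy {N : Seminorm ℝ V} {η : Module.Dual ℝ V} {v : V}
    (h : η ∈ subdifferential (energy N) v) : η v = N v ^ 2 := by
  have key : ∀ s : ℝ, s * η v ≤ N v ^ 2 * (2 * s + s ^ 2) / 2 := by
    intro s
    have h1 := h ((1 + s) • v)
    have h2 : (1 + s) • v - v = s • v := by module
    rw [h2, map_smul, smul_eq_mul] at h1
    simp only [energy, map_smul_eq_mul, mul_pow, Real.norm_eq_abs, sq_abs] at h1
    linarith
  have hlim : Tendsto (fun s : ℝ => N v ^ 2 * (2 + s) / 2) (𝓝 0) (𝓝 (N v ^ 2)) := by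
    have : Continuous (fun s : ℝ => N v ^ 2 * (2 + s) / 2) := by fun_prop
    simpa using this.tendsto 0
  apply le_antisymm
  · refine ge_of_tendsto (hlim.mono_left (nhdsWithin_le_nhds (s := Ioi 0))) ?_
    filter_upwards [self_mem_nhdsWithin] with s hs
    have hs : 0 < s := hs
    have := key s
    nlinarith
  · refine le_of_tendsto (hlim.mono_left (nhdsWithin_le_nhds (s := Iio 0))) ?_
    filter_upwards [self_mem_nhdsWithin] with s hs
    have hs : s < 0 := hs
    have := key s
    nlinarith

theorem apply_le_of_mem_subdifferential_energy {N : Seminorm ℝ V} {η : Module.Dual ℝ V} {v : V}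
    (h : η ∈ subdifferential (energy N) v) (w : V) : η w ≤ N v * N w := by
  have key : ∀ s : ℝ, s * η w ≤ (s ^ 2 * N w ^ 2 + N v ^ 2) / 2 := by
    intro s
    have h1 := h (s • w)
    rw [map_sub, map_smul, smul_eq_mul, apply_self_of_mem_subdifferential_energy h] at h1
    simp only [energy, map_smul_eq_mul, mul_pow, Real.norm_eq_abs, sq_abs] at h1
    linarith
  have hv : 0 ≤ N v := apply_nonneg N v
  have hw : 0 ≤ N w := apply_nonneg N w
  by_contra! hlt
  have hpos : 0 < η w := lt_of_le_of_lt (mul_nonneg hv hw) hlt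
  rcases eq_or_lt_of_le hw with hw0 | hw0
  -- When `N w = 0` the bound in `key` does not depend on `s`, so a large `s` violates it.
  · have := key ((N v ^ 2 + 1) / η w)
    rw [div_mul_cancel₀ _ hpos.ne', ← hw0] at this
    nlinarith
  -- This `s` maximizes `s * η w - s ^ 2 * N w ^ 2 / 2`.
  · have := key (η w / N w ^ 2)
    have h2 : (η w / N w ^ 2) ^ 2 * N w ^ 2 = η w / N w ^ 2 * η w := by field_simp
    rw [h2] at this
    have h3 : η w / N w ^ 2 * η w ≤ N v ^ 2 := by linarith
    rw [div_mul_eq_mul_div, div_le_iff₀ (by positivity)] at h3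
    nlinarith [mul_nonneg hv hw]

/-- The support function of the finite set `X`. -/
noncomputable def supportFunction (X : Finset V) (hX : X.Nonempty) (η : V →L[ℝ] ℝ) : ℝ :=
  X.sup' hX η

variable {X : Finset V} (hX : X.Nonempty)

theorem apply_le_supportFunction (η : V →L[ℝ] ℝ) {x : V} (hx : x ∈ X) :
    η x ≤ supportFunction X hX η :=
  Finset.le_sup' (f := η) hx

theorem exists_apply_eq_supportFunction (η : V →L[ℝ] ℝ) :
    ∃ x ∈ X, supportFunction X hX η = η x :=
  Finset.exists_mem_eq_sup' hX η

theorem supportFunction_smul {c : ℝ} (hc : 0 ≤ c) (η : V →L[ℝ] ℝ) :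
    supportFunction X hX (c • η) = c * supportFunction X hX η := by
  apply le_antisymm
  · obtain ⟨x, hx, h⟩ := exists_apply_eq_supportFunction hX (c • η)
    rw [h]
    exact mul_le_mul_of_nonneg_left (apply_le_supportFunction hX η hx) hc
  · obtain ⟨x, hx, h⟩ := exists_apply_eq_supportFunction hX η
    rw [h]
    exact apply_le_supportFunction hX (c • η) hx

theorem exists_lipschitzWith_supportFunction : ∃ K, LipschitzWith K (supportFunction X hX) := by
  refine ⟨∑ x ∈ X, ‖x‖₊, LipschitzWith.of_le_add_mul _ fun η ξ => ?_⟩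
  obtain ⟨x, hx, h⟩ := exists_apply_eq_supportFunction hX η
  have h1 : ‖x‖ ≤ ∑ x ∈ X, ‖x‖ := Finset.single_le_sum (fun y _ => norm_nonneg y) hx
  have h2 := (le_abs_self _).trans ((η - ξ).le_opNorm x)
  have h3 := apply_le_supportFunction hX ξ hx
  have h4 : ‖η - ξ‖ * ‖x‖ ≤ ‖η - ξ‖ * ∑ x ∈ X, ‖x‖ := by gcongr
  rw [h, dist_eq_norm]
  push_cast
  rw [sub_apply] at h2
  linarith

variable {N : Seminorm ℝ V} (hXN : N.closedBall 0 1 = convexHull ℝ (X : Set V))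
include hXN

theorem seminorm_le_one_of_mem {x : V} (hx : x ∈ X) : N x ≤ 1 := by
  have : x ∈ N.closedBall 0 1 := hXN ▸ subset_convexHull ℝ _ hx
  simpa [Seminorm.mem_closedBall] using this

theorem apply_le_supportFunction_of_le_one (η : V →L[ℝ] ℝ) {v : V} (hv : N v ≤ 1) :
    η v ≤ supportFunction X hX η := by
  have h1 : v ∈ convexHull ℝ (X : Set V) := by
    rw [← hXN]; simpa [Seminorm.mem_closedBall] using hv
  have h2 : convexHull ℝ (X : Set V) ⊆ {w | η w ≤ supportFunction X hX η} :=
    convexHull_min (fun x hx => apply_le_supportFunction hX η hx)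
      (convex_halfSpace_le η.isLinear _)
  exact h2 h1

theorem supportFunction_nonneg (η : V →L[ℝ] ℝ) : 0 ≤ supportFunction X hX η := by
  simpa using apply_le_supportFunction_of_le_one hX hXN η (v := 0) (by simp)

theorem apply_le_supportFunction_mul (hN : IsNorm N) (η : V →L[ℝ] ℝ) (v : V) :
    η v ≤ supportFunction X hX η * N v := by
  rcases eq_or_lt_of_le (apply_nonneg N v) with h | h
  · simp [hN v h.symm]
  · have h1 : N ((N v)⁻¹ • v) ≤ 1 := by
      rw [map_smul_eq_mul, norm_inv, Real.norm_of_nonneg h.le, inv_mul_cancel₀ h.ne']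
    have := apply_le_supportFunction_of_le_one hX hXN η h1
    rw [map_smul, smul_eq_mul, inv_mul_le_iff₀ h] at this
    linarith

theorem abs_apply_le_supportFunction_mul (hN : IsNorm N) (η : V →L[ℝ] ℝ) (v : V) :
    |η v| ≤ supportFunction X hX η * N v := by
  rw [abs_le']
  refine ⟨apply_le_supportFunction_mul hX hXN hN η v, ?_⟩
  have := apply_le_supportFunction_mul hX hXN hN η (-v)
  rwa [map_neg, map_neg_eq_map] at this

theorem supportFunction_eq_of_mem_subdifferential (hN : IsNorm N) {η : V →L[ℝ] ℝ} {v : V}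
    (h : η.toLinearMap ∈ subdifferential (energy N) v) : supportFunction X hX η = N v := by
  have hv : 0 ≤ N v := apply_nonneg N v
  apply le_antisymm
  · obtain ⟨x, hx, hxe⟩ := exists_apply_eq_supportFunction hX η
    rw [hxe]
    refine (apply_le_of_mem_subdifferential_energy h x).trans ?_
    exact mul_le_of_le_one_right hv (seminorm_le_one_of_mem hXN hx)
  · rcases eq_or_lt_of_le hv with h0 | h0
    · rw [← h0]
      exact supportFunction_nonneg hX hXN η
    · have h1 := apply_self_of_mem_subdifferential_energy h
      have h2 := apply_le_supportFunction_mul hX hXN hN η v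
      have h3 : η v = N v ^ 2 := h1
      nlinarith

/-- The norm of `V` only supplies the topology and is a priori unrelated to `N`. This half of their
equivalence holds because a convex hull of finitely many points is bounded. -/
theorem exists_norm_le_mul_seminorm (hN : IsNorm N) : ∃ K : ℝ, 0 ≤ K ∧ ∀ v, ‖v‖ ≤ K * N v := by
  have hb : Bornology.IsBounded (convexHull ℝ (X : Set V)) :=
    isBounded_convexHull.2 X.finite_toSet.isBounded
  obtain ⟨K, hK⟩ := hb.exists_norm_le
  refine ⟨K, ?_, fun v => ?_⟩
  · have : (0 : V) ∈ convexHull ℝ (X : Set V) := by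
      rw [← hXN]; simp [Seminorm.mem_closedBall]
    exact (norm_nonneg _).trans (hK 0 this)
  · rcases eq_or_lt_of_le (apply_nonneg N v) with h | h
    · simp [hN v h.symm]
    · have h1 : (N v)⁻¹ • v ∈ convexHull ℝ (X : Set V) := by
        rw [← hXN, Seminorm.mem_closedBall, sub_zero, map_smul_eq_mul, norm_inv,
          Real.norm_of_nonneg h.le, inv_mul_cancel₀ h.ne']
      have := hK _ h1
      rw [norm_smul, norm_inv, Real.norm_of_nonneg h.le, inv_mul_le_iff₀ h] at this
      linarith

theorem nonempty_of_closedBall_eq_convexHull : X.Nonempty := by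
  have : (0 : V) ∈ convexHull ℝ (X : Set V) := by
    rw [← hXN]; simp [Seminorm.mem_closedBall]
  simpa using convexHull_nonempty_iff.1 ⟨0, this⟩

omit hXN in
theorem continuous_seminorm_of_finiteDimensional [FiniteDimensional ℝ V] (N : Seminorm ℝ V) :
    Continuous N := by
  exact N.convexOn.locallyLipschitz.continuous

/-- The vertices at which a normalized functional is almost maximal lie in a common face. -/
theorem exists_pos_forall_exists_common_face [FiniteDimensional ℝ V] (hN : IsNorm N) :
    ∃ ε : ℝ, 0 < ε ∧ ∀ η : V →L[ℝ] ℝ, supportFunction X hX η = 1 →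
      ∃ ξ : V →L[ℝ] ℝ, supportFunction X hX ξ = 1 ∧ ∀ x ∈ X, 1 - ε ≤ η x → ξ x = 1 := by
  obtain ⟨K, hK⟩ := exists_lipschitzWith_supportFunction hX
  obtain ⟨c, hc, hcN⟩ :=
    N.bound_of_continuous_normedSpace (continuous_seminorm_of_finiteDimensional N)
  have hcomp : IsCompact {η : V →L[ℝ] ℝ | supportFunction X hX η = 1} := by
    refine Metric.isCompact_of_isClosed_isBounded (isClosed_eq hK.continuous continuous_const) ?_
    refine (Metric.isBounded_closedBall (x := (0 : V →L[ℝ] ℝ)) (r := c)).subset fun η hη => ?_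
    rw [mem_closedBall_zero_iff]
    refine η.opNorm_le_bound hc.le fun v => ?_
    have := abs_apply_le_supportFunction_mul hX hXN hN η v
    rw [show supportFunction X hX η = 1 from hη, one_mul] at this
    exact this.trans (hcN v)
  -- Compactness of the dual sphere makes a local choice of `ε` uniform.
  have hev : ∀ᶠ ε : ℝ in 𝓝 0, ∀ η ∈ {η : V →L[ℝ] ℝ | supportFunction X hX η = 1},
      ∃ ξ : V →L[ℝ] ℝ, supportFunction X hX ξ = 1 ∧ ∀ x ∈ X, 1 - ε ≤ η x → ξ x = 1 := by
    refine hcomp.eventually_forall_of_forall_eventually fun η hη => ?_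
    -- Each of the finitely many vertices not maximal for `η` misses the maximum by a gap, which
    -- persists nearby. So `ξ = η` serves all functionals close to `η`.
    have : ∀ᶠ z : ℝ × (V →L[ℝ] ℝ) in 𝓝 (0, η), ∀ x ∈ X, 1 - z.1 ≤ z.2 x → η x = 1 := by
      rw [Filter.eventually_all_finset]
      intro x hx
      by_cases h1 : η x = 1
      · exact Eventually.of_forall fun _ _ => h1
      · have h2 : η x < 1 := lt_of_le_of_ne (hη ▸ apply_le_supportFunction hX η hx) h1
        have h3 : Continuous fun z : ℝ × (V →L[ℝ] ℝ) => z.2 x + z.1 := by fun_prop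
        have h4 := h3.continuousAt.eventually_lt (x₀ := (0, η)) continuousAt_const
          (g := fun _ => (1 : ℝ)) (by simpa using h2)
        filter_upwards [h4] with z hz hz'
        linarith
    filter_upwards [this] with z hz
    exact ⟨η, hη, hz⟩
  obtain ⟨ε, hε, h⟩ := ((hev.filter_mono nhdsWithin_le_nhds).and
    (self_mem_nhdsWithin (s := Ioi (0 : ℝ)))).exists
  exact ⟨ε, h, hε⟩

/-- If a functional attains its maximum over a ball at `v`, then every functional attaining its
maximum at all the vertices on which the former is maximal attains its maximum at `v`. -/
theorem apply_eq_of_forall_vertex {η ξ : V →L[ℝ] ℝ} {r : ℝ} {v : V} (hv : N v ≤ 1)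
    (hη : supportFunction X hX η = r) (hηv : η v = r)
    (h : ∀ x ∈ X, η x = r → ξ x = 1) : ξ v = 1 := by
  have h1 : v ∈ convexHull ℝ (X : Set V) := by
    rw [← hXN]; simpa [Seminorm.mem_closedBall] using hv
  rw [Finset.mem_convexHull'] at h1
  obtain ⟨w, hw0, hw1, hwv⟩ := h1
  -- All terms are nonnegative, so the weights vanish off the vertices where `η` is maximal.
  have h2 : ∑ x ∈ X, w x * (r - η x) = 0 := by
    have : ∑ x ∈ X, w x * η x = r := by
      rw [← hηv, ← hwv, map_sum]
      simp
    simp only [mul_sub, Finset.sum_sub_distrib, this, ← Finset.sum_mul, hw1, one_mul, sub_self]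
  have h3 := (Finset.sum_eq_zero_iff_of_nonneg (fun x hx => mul_nonneg (hw0 x hx)
    (sub_nonneg.2 (hη ▸ apply_le_supportFunction hX η hx)))).1 h2
  have h4 : ∀ x ∈ X, w x * ξ x = w x := by
    intro x hx
    rcases mul_eq_zero.1 (h3 x hx) with h5 | h5
    · simp [h5]
    · rw [h x hx (by linarith), mul_one]
  rw [← hwv, map_sum, ← hw1]
  exact Finset.sum_congr rfl fun x hx => by rw [map_smul, smul_eq_mul, h4 x hx]

end Convex

/-! ### Curves of covectors satisfying `η' = η ∘ D u` with `D` alternating. -/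

section Curve

theorem _root_.LipschitzOnWith.comp_absolutelyContinuousOnInterval {X Y : Type*}
    [PseudoMetricSpace X] [PseudoMetricSpace Y] {g : X → Y} {f : ℝ → X} {K : NNReal} {s : Set X}
    {a b : ℝ} (hg : LipschitzOnWith K g s) (hf : AbsolutelyContinuousOnInterval f a b)
    (hs : MapsTo f (uIcc a b) s) : AbsolutelyContinuousOnInterval (g ∘ f) a b := by
  unfold AbsolutelyContinuousOnInterval at hf ⊢
  refine squeeze_zero' (Eventually.of_forall fun _ => Finset.sum_nonneg fun _ _ => dist_nonneg) ?_
    (by simpa using hf.const_mul (K : ℝ))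
  rw [eventually_inf_principal]
  refine Eventually.of_forall fun I hI => ?_
  rw [Finset.mul_sum]
  refine Finset.sum_le_sum fun i hi => ?_
  obtain ⟨h1, h2⟩ := hI.1 i hi
  exact hg.dist_le_mul _ (hs h1) _ (hs h2)

theorem _root_.AbsolutelyContinuousOnInterval.congr_of_eqOn {X : Type*} [PseudoMetricSpace X]
    {f g : ℝ → X} {a b : ℝ} (hf : AbsolutelyContinuousOnInterval f a b)
    (h : EqOn f g (uIcc a b)) : AbsolutelyContinuousOnInterval g a b := by
  unfold AbsolutelyContinuousOnInterval at hf ⊢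
  refine hf.congr' ?_
  rw [EventuallyEq, eventually_inf_principal]
  refine Eventually.of_forall fun I hI => Finset.sum_congr rfl fun i hi => ?_
  obtain ⟨h1, h2⟩ := hI.1 i hi
  rw [h h1, h h2]

variable {V : Type*} [NormedAddCommGroup V] [NormedSpace ℝ V]
  {X : Finset V} (hX : X.Nonempty)
  {N : Seminorm ℝ V} (hXN : N.closedBall 0 1 = convexHull ℝ (X : Set V)) (hN : IsNorm N)
  {D : V →L[ℝ] V →L[ℝ] V} (hD : ∀ v, D v v = 0)
  {J : Set ℝ} {η : ℝ → V →L[ℝ] ℝ} {u : ℝ → V}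

include hXN hN hD in
theorem hasDerivAt_supportFunction_zero {t : ℝ} (hη : HasDerivAt η (η t ∘L D (u t)) t)
    (hsub : (η t).toLinearMap ∈ subdifferential (energy N) (u t))
    (hdiff : DifferentiableAt ℝ (fun s => supportFunction X hX (η s)) t) :
    HasDerivAt (fun s => supportFunction X hX (η s)) 0 t := by
  have hd := hdiff.hasDerivAt
  set d := deriv (fun s => supportFunction X hX (η s)) t
  have heq := supportFunction_eq_of_mem_subdifferential hX hXN hN hsub
  suffices d = 0 by rwa [this] at hd
  rcases eq_or_lt_of_le (apply_nonneg N (u t)) with h0 | h0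
  -- If `N (u t) = 0`, the nonnegative function `h ∘ η` vanishes at `t`, a minimum.
  · refine IsLocalMin.hasDerivAt_eq_zero (Eventually.of_forall fun s => ?_) hd
    simp only [heq, ← h0]
    exact supportFunction_nonneg hX hXN (η s)
  · have h1 : HasDerivAt (fun s => η s (u t)) 0 t := by
      have := hη.clm_apply (hasDerivAt_const t (u t))
      simpa [hD] using this
    have h2 := (hd.mul_const (N (u t))).sub h1
    -- With `u t` frozen, the duality gap `h (η s) * N (u t) - η s (u t)` is nonnegative and zero at
    -- `s = t`.
    have h3 : d * N (u t) - 0 = 0 := by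
      refine IsLocalMin.hasDerivAt_eq_zero (Eventually.of_forall fun s => ?_) h2
      have h4 : η t (u t) = N (u t) ^ 2 := apply_self_of_mem_subdifferential_energy hsub
      have h5 := apply_le_supportFunction_mul hX hXN hN (η s) (u t)
      simp only [Pi.sub_apply, heq, h4]
      linarith
    rw [sub_zero] at h3
    exact (mul_eq_zero.1 h3).resolve_right h0.ne'

include hXN hN hD in
-- An absolutely continuous function with derivative zero almost everywhere is constant. Absolute
-- continuity is assumed only near each point, as charts provide it, and connectedness of `J`
-- patches the local statements.
theorem supportFunction_eq_of_absolutelyContinuous (hJ : J.OrdConnected)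
    (hac : ∀ x ∈ J, ∀ᶠ y in 𝓝[J] x, AbsolutelyContinuousOnInterval η x y)
    (hη : ∀ᵐ t ∂(volume.restrict J), HasDerivAt η (η t ∘L D (u t)) t)
    (hsub : ∀ᵐ t ∂(volume.restrict J), (η t).toLinearMap ∈ subdifferential (energy N) (u t))
    {s t : ℝ} (hs : s ∈ J) (ht : t ∈ J) :
    supportFunction X hX (η s) = supportFunction X hX (η t) := by
  obtain ⟨K, hK⟩ := exists_lipschitzWith_supportFunction hX
  rw [ae_restrict_iff' hJ.measurableSet] at hη hsub
  refine hJ.isPreconnected.induction₂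
    (fun s t => supportFunction X hX (η s) = supportFunction X hX (η t)) (fun x hx => ?_)
    (fun x y z _ _ _ h1 h2 => h1.trans h2) (fun x y _ _ h => h.symm) hs ht
  filter_upwards [hac x hx, self_mem_nhdsWithin] with y hy hyJ
  have hh : AbsolutelyContinuousOnInterval (fun s => supportFunction X hX (η s)) x y :=
    (hK.lipschitzOnWith (s := univ)).comp_absolutelyContinuousOnInterval hy (mapsTo_univ _ _)
  obtain ⟨C, hC⟩ := hh.const_of_ae_hasDerivAt_zero (by
    filter_upwards [hη, hsub, hh.boundedVariationOn.ae_differentiableAt_of_mem_uIcc]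
      with z h1 h2 h3 hz
    have hzJ := hJ.uIcc_subset hx hyJ hz
    exact hasDerivAt_supportFunction_zero hX hXN hN hD (h1 hzJ) (h2 hzJ) (h3 hz))
  rw [hC x left_mem_uIcc, hC y right_mem_uIcc]

include hXN hN in
theorem abs_apply_sub_le_setIntegral (hJ : J.OrdConnected) {r C : ℝ}
    (hC : ∀ x ∈ X, ∀ v, N (D v x) ≤ C * N v)
    (hu : IntegrableOn (fun t => N (u t)) J)
    (hac : ∀ x ∈ J, ∀ᶠ y in 𝓝[J] x, AbsolutelyContinuousOnInterval η x y)
    (hη : ∀ᵐ t ∂(volume.restrict J), HasDerivAt η (η t ∘L D (u t)) t)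
    (hr : ∀ t ∈ J, supportFunction X hX (η t) = r) {x : V} (hx : x ∈ X)
    {s t : ℝ} (hs : s ∈ J) (ht : t ∈ J) :
    |η t x - η s x| ≤ r * C * ∫ z in J, N (u z) := by
  have hr0 : 0 ≤ r := hr s hs ▸ supportFunction_nonneg hX hXN _
  set φ : ℝ → ℝ := fun t => η t x
  have hderiv : ∀ᵐ z ∂(volume.restrict J), ‖deriv φ z‖ ≤ r * C * N (u z) := by
    filter_upwards [hη, ae_restrict_mem hJ.measurableSet] with z hz hzJ
    have h1 : HasDerivAt φ (η z (D (u z) x)) z := by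
      have := hz.clm_apply (hasDerivAt_const z x)
      simpa using this
    rw [h1.deriv, Real.norm_eq_abs, mul_assoc, ← hr z hzJ]
    refine (abs_apply_le_supportFunction_mul hX hXN hN _ _).trans ?_
    exact mul_le_mul_of_nonneg_left (hC x hx _) (supportFunction_nonneg hX hXN _)
  have hint : IntegrableOn (deriv φ) J :=
    Integrable.mono' (hu.const_mul (r * C)) (measurable_deriv φ).aestronglyMeasurable hderiv
  have hii : ∀ {a b : ℝ}, a ∈ J → b ∈ J → IntervalIntegrable (deriv φ) volume a b :=
    fun ha hb => (hint.mono_set (hJ.uIcc_subset ha hb)).intervalIntegrable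
  have hftc : φ t - φ s = ∫ z in s..t, deriv φ z := by
    refine hJ.isPreconnected.induction₂
      (fun s t => φ t - φ s = ∫ z in s..t, deriv φ z) (fun y hy => ?_)
      (fun a b c ha hb hc h1 h2 => ?_) (fun a b _ _ h => ?_) hs ht
    · filter_upwards [hac y hy] with z hz
      have : AbsolutelyContinuousOnInterval φ y z :=
        ((ContinuousLinearMap.apply ℝ ℝ x).lipschitz.lipschitzOnWith
          (s := univ)).comp_absolutelyContinuousOnInterval hz (mapsTo_univ _ _)
      exact this.integral_deriv_eq_sub.symm
    · rw [← intervalIntegral.integral_add_adjacent_intervals (hii ha hb) (hii hb hc), ← h1, ← h2]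
      ring
    · rw [intervalIntegral.integral_symm, ← h]
      ring
  have hsubs : uIoc s t ⊆ J := uIoc_subset_uIcc.trans (hJ.uIcc_subset hs ht)
  calc |φ t - φ s| = ‖∫ z in s..t, deriv φ z‖ := by rw [hftc, Real.norm_eq_abs]
    _ ≤ ∫ z in uIoc s t, ‖deriv φ z‖ := intervalIntegral.norm_integral_le_integral_norm_uIoc
    _ ≤ ∫ z in J, ‖deriv φ z‖ :=
      setIntegral_mono_set hint.norm (Eventually.of_forall fun _ => norm_nonneg _)
        hsubs.eventuallyLE
    _ ≤ ∫ z in J, r * C * N (u z) := integral_mono_ae hint.norm (hu.const_mul _) hderiv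
    _ = r * C * ∫ z in J, N (u z) := integral_const_mul _ _

theorem exists_forall_takesValuesInFace [FiniteDimensional ℝ V] {N : Seminorm ℝ V}
    (hN : IsNorm N) (hpoly : IsPolyhedral N) (hD : ∀ v, D v v = 0) :
    ∃ L : ℝ, 0 < L ∧ ∀ (J : Set ℝ) (η : ℝ → V →L[ℝ] ℝ) (u : ℝ → V), J.OrdConnected →
      AEStronglyMeasurable u (volume.restrict J) →
      (∀ x ∈ J, ∀ᶠ y in 𝓝[J] x, AbsolutelyContinuousOnInterval η x y) →
      (∀ᵐ t ∂(volume.restrict J), HasDerivAt η (η t ∘L D (u t)) t) →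
      (∀ᵐ t ∂(volume.restrict J), (η t).toLinearMap ∈ subdifferential (energy N) (u t)) →
      0 < ∫⁻ t in J, ENNReal.ofReal (N (u t)) →
      ∫⁻ t in J, ENNReal.ofReal (N (u t)) < ENNReal.ofReal L → TakesValuesInFace N J u := by
  obtain ⟨S, hS, hSN⟩ := hpoly
  obtain ⟨X, rfl⟩ := hS.exists_finset_coe
  have hX := nonempty_of_closedBall_eq_convexHull hSN
  obtain ⟨ε, hε, hface⟩ := exists_pos_forall_exists_common_face hX hSN hN
  obtain ⟨K, hK0, hK⟩ := exists_norm_le_mul_seminorm hSN hN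
  have hNc := continuous_seminorm_of_finiteDimensional N
  obtain ⟨c, hc, hcN⟩ := N.bound_of_continuous_normedSpace hNc
  set C : ℝ := c * ‖D‖ * K * K with hCdef
  have hC0 : 0 ≤ C := by positivity
  have hC : ∀ x ∈ X, ∀ v, N (D v x) ≤ C * N v := by
    intro x hx v
    have h1 : ‖x‖ ≤ K := (hK x).trans (mul_le_of_le_one_right hK0 (seminorm_le_one_of_mem hSN hx))
    have h2 : 0 ≤ N v := apply_nonneg N v
    calc N (D v x) ≤ c * ‖D v x‖ := hcN _
      _ ≤ c * (‖D‖ * ‖v‖ * ‖x‖) := by gcongr; exact D.le_opNorm₂ v x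
      _ ≤ c * (‖D‖ * (K * N v) * K) := by gcongr; exact hK v
      _ = C * N v := by rw [hCdef]; ring
  -- Length below this bound forces `C * length ≤ ε`; the `+ 1` covers `C = 0`, e.g. `D = 0`.
  refine ⟨ε / (C + 1), by positivity, fun J η u hJ hum hac hη hsub hpos hlt => ?_⟩
  have hint : IntegrableOn (fun t => N (u t)) J := by
    refine ⟨hNc.comp_aestronglyMeasurable hum, ?_⟩
    rw [hasFiniteIntegral_iff_ofReal (Eventually.of_forall fun t => apply_nonneg N _)]
    exact hlt.trans ENNReal.ofReal_lt_top
  have hI : ∫ t in J, N (u t) < ε / (C + 1) := by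
    rw [← ofReal_integral_eq_lintegral_ofReal hint
      (Eventually.of_forall fun t => apply_nonneg N _)] at hlt
    exact (ENNReal.ofReal_lt_ofReal_iff (by positivity)).1 hlt
  obtain ⟨t₀, ht₀⟩ : J.Nonempty := by
    by_contra! h
    simp [h] at hpos
  set r := supportFunction X hX (η t₀) with hrdef
  have hr : ∀ t ∈ J, supportFunction X hX (η t) = r := fun t ht =>
    supportFunction_eq_of_absolutelyContinuous hX hSN hN hD hJ hac hη hsub ht ht₀
  have hNu : ∀ᵐ t ∂(volume.restrict J), N (u t) = r := by
    filter_upwards [hsub, ae_restrict_mem hJ.measurableSet] with t h1 h2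
    rw [← hr t h2, supportFunction_eq_of_mem_subdifferential hX hSN hN h1]
  -- Positive length enters here: `r = 0` would give `N (u t) = 0` almost everywhere.
  have hr0 : 0 < r := by
    refine lt_of_le_of_ne (supportFunction_nonneg hX hSN _) fun h => hpos.ne' ?_
    rw [lintegral_congr_ae (g := 0)]
    · simp
    · filter_upwards [hNu] with t ht
      simp [ht, ← h]
  -- The face is fixed once and for all by the normalized covector at time `t₀`.
  obtain ⟨ξ, hξ, hξX⟩ := hface (r⁻¹ • η t₀) (by
    rw [supportFunction_smul hX (by positivity), ← hrdef, inv_mul_cancel₀ hr0.ne'])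
  refine ⟨r, hr0, _, ⟨ξ.toLinearMap, ?_, rfl⟩, ?_⟩
  · intro h0
    have : ξ = 0 := by ext v; exact LinearMap.congr_fun h0 v
    obtain ⟨x, -, hx⟩ := exists_apply_eq_supportFunction hX ξ
    rw [hξ, this] at hx
    simp at hx
  filter_upwards [hsub, hNu, ae_restrict_mem hJ.measurableSet] with t ht1 ht2 ht3
  have hv1 : N (r⁻¹ • u t) = 1 := by
    rw [map_smul_eq_mul, ht2, norm_inv, Real.norm_of_nonneg hr0.le, inv_mul_cancel₀ hr0.ne']
  have hηv : η t (r⁻¹ • u t) = r := by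
    have : η t (u t) = N (u t) ^ 2 := apply_self_of_mem_subdifferential_energy ht1
    rw [map_smul, this, ht2, smul_eq_mul]
    field_simp
  have hξv : ξ (r⁻¹ • u t) = 1 := by
    -- A vertex with `η t x = r` has `η t₀ x ≥ r - r * ε`, hence lies in the face of `ξ`.
    refine apply_eq_of_forall_vertex hX hSN hv1.le (hr t ht3) hηv fun x hx hxr => hξX x hx ?_
    have h1 := abs_apply_sub_le_setIntegral hX hSN hN hJ hC hint hac hη hr hx ht₀ ht3
    have h2 : C * ∫ z in J, N (u z) ≤ ε := by
      rw [lt_div_iff₀ (by positivity)] at hI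
      have : 0 ≤ ∫ z in J, N (u z) := integral_nonneg fun z => apply_nonneg N _
      linarith
    have h3 := (abs_le.1 h1).2
    rw [hxr] at h3
    have h4 : r * (C * ∫ z in J, N (u z)) ≤ r * ε := by gcongr
    rw [smul_apply, smul_eq_mul, le_inv_mul_iff₀ hr0]
    linarith
  have hξu : ξ (u t) = r := by
    rw [map_smul, smul_eq_mul, inv_mul_eq_one₀ hr0.ne'] at hξv
    exact hξv.symm
  refine ⟨by simp [Seminorm.mem_closedBall, ht2], fun w hw => ?_⟩
  rw [Seminorm.mem_closedBall, sub_zero] at hw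
  change ξ w ≤ ξ (u t)
  rw [hξu]
  have := apply_le_supportFunction_mul hX hSN hN ξ w
  rw [hξ, one_mul] at this
  exact this.trans hw

end Curve

/-! ### Alternation of the bracket, by calculus in a vector space. -/

section Calculus

variable {E : Type*} [NormedAddCommGroup E] [NormedSpace ℝ E]

/-- If `m` is the multiplication and `c` the conjugation of a local Lie group, the mixed second
derivative of `c` at the identity is alternating. -/
theorem fderiv_fderiv_conj_apply_self {m c : E × E → E} {p : E}
    (hm : ContDiffAt ℝ 2 m (p, p)) (hc : ContDiffAt ℝ 2 c (p, p))
    (hcp : ∀ᶠ x in 𝓝 p, c (x, p) = p) (hpc : ∀ᶠ y in 𝓝 p, c (p, y) = y)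
    (hmp : ∀ᶠ x in 𝓝 p, m (x, p) = x)
    (hmc : ∀ᶠ z in 𝓝 (p, p), m (c z, z.1) = m z) (u : E) :
    fderiv ℝ (fun x => fderiv ℝ (fun y => c (x, y)) p) p u u = 0 := by
  set B : E → E →L[ℝ] E := fun x => fderiv ℝ (fun y => c (x, y)) p with hBdef
  have hB : DifferentiableAt ℝ B p :=
    (ContDiffAt.fderiv (f := fun x y => c (x, y)) (g := fun _ => p) (m := 1) hc
      contDiffAt_const (by norm_num)).differentiableAt one_ne_zero
  have hM : DifferentiableAt ℝ (fderiv ℝ m) (p, p) :=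
    (hm.fderiv_right (m := 1) (by norm_num)).differentiableAt one_ne_zero
  set M' := fderiv ℝ (fderiv ℝ m) (p, p) with hM'
  have hsymm : M' (0, u) (u, 0) = M' (u, 0) (0, u) := hm.isSymmSndFDerivAt (by simp) _ _
  have hBp : B p = ContinuousLinearMap.id ℝ E := by
    have : (fun y => c (p, y)) =ᶠ[𝓝 p] id := hpc
    rw [hBdef]
    simp only [this.fderiv_eq, fderiv_id]
  have hdm : ∀ᶠ z in 𝓝 (p, p), DifferentiableAt ℝ m z :=
    (hm.eventually (by simp)).mono fun z hz => hz.differentiableAt (by simp)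
  have hdc : ∀ᶠ z in 𝓝 (p, p), DifferentiableAt ℝ c z :=
    (hc.eventually (by simp)).mono fun z hz => hz.differentiableAt (by simp)
  have hl : Tendsto (fun x : E => (x, p)) (𝓝 p) (𝓝 (p, p)) :=
    (Continuous.prodMk continuous_id continuous_const).tendsto p
  have hr : Tendsto (fun x : E => (p, x)) (𝓝 p) (𝓝 (p, p)) :=
    (Continuous.prodMk continuous_const continuous_id).tendsto p
  have hmp' : ∀ w : E, fderiv ℝ m (p, p) (w, 0) = w := by
    intro w
    have h1 : HasFDerivAt (fun x => m (x, p)) (fderiv ℝ m (p, p) ∘L .inl ℝ E E) p :=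
      hdm.self_of_nhds.hasFDerivAt.comp (f := fun x => (x, p)) p
        (hasFDerivAt_prodMk_left p p)
    have h2 : HasFDerivAt (fun x => m (x, p)) (.id ℝ E) p :=
      (hasFDerivAt_id p).congr_of_eventuallyEq hmp
    exact congrArg (fun f : E →L[ℝ] E => f w) (h1.unique h2)
  -- Differentiate `(x y x⁻¹) x = x y`, i.e. `m (c (x, y), x) = m (x, y)`, in `y` at `p`.
  have key : ∀ᶠ x in 𝓝 p, fderiv ℝ m (p, x) (B x u, 0) = fderiv ℝ m (x, p) (0, u) := by
    have hmc' : ∀ᶠ x in 𝓝 p, ∀ᶠ y in 𝓝 p, m (c (x, y), x) = m (x, y) :=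
      hmc.curry_nhds
    filter_upwards [hmc', hl.eventually hdm, hr.eventually hdm, hl.eventually hdc, hcp]
      with x h1 h2 h3 h4 h5
    have h6 : HasFDerivAt (fun y => c (x, y)) (B x) p :=
      (DifferentiableAt.fun_comp' p h4
        (hasFDerivAt_prodMk_right x p).differentiableAt).hasFDerivAt
    have h7 : HasFDerivAt (fun y => m (c (x, y), x))
        (fderiv ℝ m (p, x) ∘L (B x).prod (0 : E →L[ℝ] E)) p := by
      refine HasFDerivAt.comp p ?_ (h6.prodMk (hasFDerivAt_const x p))
      rw [h5]
      exact h3.hasFDerivAt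
    have h8 : HasFDerivAt (fun y => m (x, y)) (fderiv ℝ m (x, p) ∘L .inr ℝ E E) p :=
      h2.hasFDerivAt.comp p (hasFDerivAt_prodMk_right x p)
    have h9 := h7.unique (h8.congr_of_eventuallyEq h1)
    simpa using congrArg (fun f : E →L[ℝ] E => f u) h9
  have hL : HasFDerivAt (fun x => fderiv ℝ m (p, x) (B x u, 0)) _ p :=
    (hM.hasFDerivAt.comp (f := fun x => (p, x)) p (hasFDerivAt_prodMk_right p p)).clm_apply
      ((hB.hasFDerivAt.clm_apply (hasFDerivAt_const u p)).prodMk (hasFDerivAt_const (0 : E) p))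
  have hR : HasFDerivAt (fun x => fderiv ℝ m (x, p) (0, u)) _ p :=
    (hM.hasFDerivAt.comp (f := fun x => (x, p)) p (hasFDerivAt_prodMk_left p p)).clm_apply
      (hasFDerivAt_const ((0 : E), u) p)
  -- Differentiating `key` in `x` along the same `u`, the mixed second derivatives of `m` cancel by
  -- symmetry, leaving the derivative of `B` along `u`, applied to `u`.
  have h := congrArg (fun f : E →L[ℝ] E => f u)
    (hL.unique (hR.congr_of_eventuallyEq key))
  simpa [hBp, hmp', hsymm, ← hM'] using h

end Calculus

/-! ### The adjoint representation in a chart, and its derivative along a curve. -/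

section Adjoint

variable {E : Type*} [NormedAddCommGroup E] [NormedSpace ℝ E]
  {G : Type*} [TopologicalSpace G] [ChartedSpace E G] [Group G] [LieGroup 𝓘(ℝ, E) ∞ G]

variable (E G) in
/-- The coordinates of the identity in the preferred chart. -/
noncomputable def identityCoord : E :=
  extChartAt 𝓘(ℝ, E) (1 : G) 1

variable (E) in
/-- Conjugation by `g` in the preferred chart at the identity. -/
noncomputable def conjInChart (g : G) (y : E) : E :=
  extChartAt 𝓘(ℝ, E) (1 : G) (g * (extChartAt 𝓘(ℝ, E) (1 : G)).symm y * g⁻¹)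

variable (E) in
/-- The adjoint map as an endomorphism of the model space. -/
noncomputable def adModel (g : G) : E →L[ℝ] E :=
  fderiv ℝ (conjInChart E g) (identityCoord E G)

omit [LieGroup 𝓘(ℝ, E) ∞ G] in
@[simp]
theorem extChartAt_symm_identityCoord :
    (extChartAt 𝓘(ℝ, E) (1 : G)).symm (identityCoord E G) = 1 :=
  extChartAt_to_inv 1

omit [LieGroup 𝓘(ℝ, E) ∞ G] in
@[simp]
theorem conjInChart_identityCoord (g : G) :
    conjInChart E g (identityCoord E G) = identityCoord E G := by
  simp [conjInChart, identityCoord]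

theorem contMDiffAt_extChartAt_one_symm :
    ContMDiffAt 𝓘(ℝ, E) 𝓘(ℝ, E) ∞ (extChartAt 𝓘(ℝ, E) (1 : G)).symm (identityCoord E G) :=
  (contMDiffOn_extChartAt_symm (1 : G)).contMDiffAt (extChartAt_target_mem_nhds 1)

theorem contMDiffAt_conj (g h : G) :
    ContMDiffAt 𝓘(ℝ, E) 𝓘(ℝ, E) ∞ (fun h : G => g * h * g⁻¹) h :=
  (contMDiffAt_const.mul contMDiffAt_id).mul contMDiffAt_const

theorem Ad_eq_adModel (g : G) : Ad E g = adModel E g := by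
  have hd : MDifferentiableAt 𝓘(ℝ, E) 𝓘(ℝ, E) (fun h : G => g * h * g⁻¹) (1 : G) :=
    (contMDiffAt_conj g 1).mdifferentiableAt (by simp)
  have h1 : g * 1 * g⁻¹ = 1 := by simp
  have h2 := hd.mfderiv
  have h3 : writtenInExtChartAt 𝓘(ℝ, E) 𝓘(ℝ, E) (1 : G) (fun h : G => g * h * g⁻¹)
      = conjInChart E g := by
    ext y
    simp only [writtenInExtChartAt, h1]
    rfl
  refine Eq.trans (b := (fderivWithin ℝ (writtenInExtChartAt 𝓘(ℝ, E) 𝓘(ℝ, E) (1 : G)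
    (fun h : G => g * h * g⁻¹)) (range 𝓘(ℝ, E)) (extChartAt 𝓘(ℝ, E) (1 : G) 1) : E →L[ℝ] E)) h2 ?_
  rw [h3, modelWithCornersSelf_coe, range_id, fderivWithin_univ]
  rfl

theorem tendsto_extChartAt_one_symm :
    Tendsto (extChartAt 𝓘(ℝ, E) (1 : G)).symm (𝓝 (identityCoord E G)) (𝓝 1) := by
  have := (contMDiffAt_extChartAt_one_symm (E := E) (G := G)).continuousAt.tendsto
  rwa [extChartAt_symm_identityCoord] at this

omit [LieGroup 𝓘(ℝ, E) ∞ G] in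
theorem eventually_extChartAt_symm_extChartAt_one :
    ∀ᶠ g in 𝓝 (1 : G), (extChartAt 𝓘(ℝ, E) (1 : G)).symm (extChartAt 𝓘(ℝ, E) (1 : G) g) = g := by
  filter_upwards [extChartAt_source_mem_nhds (I := 𝓘(ℝ, E)) (1 : G)] with g hg
  exact (extChartAt 𝓘(ℝ, E) (1 : G)).left_inv hg

omit [LieGroup 𝓘(ℝ, E) ∞ G] in
theorem eventually_extChartAt_extChartAt_one_symm :
    ∀ᶠ y in 𝓝 (identityCoord E G),
      extChartAt 𝓘(ℝ, E) (1 : G) ((extChartAt 𝓘(ℝ, E) (1 : G)).symm y) = y := by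
  filter_upwards [extChartAt_target_mem_nhds (I := 𝓘(ℝ, E)) (1 : G)] with y hy
  exact (extChartAt 𝓘(ℝ, E) (1 : G)).right_inv hy

theorem differentiableAt_conjInChart (g : G) :
    DifferentiableAt ℝ (conjInChart E g) (identityCoord E G) := by
  have h1 : ContMDiffAt 𝓘(ℝ, E) 𝓘(ℝ, E) ∞ (conjInChart E g) (identityCoord E G) := by
    refine ContMDiffAt.comp (I' := 𝓘(ℝ, E)) (identityCoord E G)
      (g := extChartAt 𝓘(ℝ, E) (1 : G)) ?_
      ((contMDiffAt_const.mul contMDiffAt_extChartAt_one_symm).mul contMDiffAt_const)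
    rw [extChartAt_symm_identityCoord, mul_one, mul_inv_cancel]
    exact contMDiffAt_extChartAt
  exact (contMDiffAt_iff_contDiffAt.1 h1).differentiableAt (by simp)

theorem adModel_mul (g h : G) : adModel E (g * h) = adModel E g ∘L adModel E h := by
  have := topologicalGroup_of_lieGroup 𝓘(ℝ, E) ∞ (G := G)
  have h1 : HasFDerivAt (conjInChart E g ∘ conjInChart E h) (adModel E g ∘L adModel E h)
      (identityCoord E G) := by
    refine HasFDerivAt.comp _ ?_ (differentiableAt_conjInChart h).hasFDerivAt
    rw [conjInChart_identityCoord]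
    exact (differentiableAt_conjInChart g).hasFDerivAt
  rw [adModel]
  refine (h1.congr_of_eventuallyEq ?_).fderiv
  have h2 : Tendsto (fun y => h * (extChartAt 𝓘(ℝ, E) (1 : G)).symm y * h⁻¹)
      (𝓝 (identityCoord E G)) (𝓝 1) := by
    have h3 : Continuous fun k : G => h * k * h⁻¹ := by fun_prop
    have h4 := h3.tendsto 1
    rw [mul_one, mul_inv_cancel] at h4
    exact h4.comp tendsto_extChartAt_one_symm
  filter_upwards [h2.eventually (eventually_extChartAt_symm_extChartAt_one (E := E))] with y hy
  simp only [conjInChart, Function.comp_apply, hy]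
  congr 1
  group

variable (E G) in
/-- Multiplication in the preferred chart at the identity. -/
noncomputable def mulInChart (z : E × E) : E :=
  extChartAt 𝓘(ℝ, E) (1 : G)
    ((extChartAt 𝓘(ℝ, E) (1 : G)).symm z.1 * (extChartAt 𝓘(ℝ, E) (1 : G)).symm z.2)

theorem contMDiffAt_extChartAt_one_symm_fst :
    ContMDiffAt 𝓘(ℝ, E × E) 𝓘(ℝ, E) ∞
      (fun z : E × E => (extChartAt 𝓘(ℝ, E) (1 : G)).symm z.1)
      (identityCoord E G, identityCoord E G) :=
  ContMDiffAt.comp (I' := 𝓘(ℝ, E)) (identityCoord E G, identityCoord E G)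
    contMDiffAt_extChartAt_one_symm contDiffAt_fst.contMDiffAt

theorem contMDiffAt_extChartAt_one_symm_snd :
    ContMDiffAt 𝓘(ℝ, E × E) 𝓘(ℝ, E) ∞
      (fun z : E × E => (extChartAt 𝓘(ℝ, E) (1 : G)).symm z.2)
      (identityCoord E G, identityCoord E G) :=
  ContMDiffAt.comp (I' := 𝓘(ℝ, E)) (identityCoord E G, identityCoord E G)
    contMDiffAt_extChartAt_one_symm contDiffAt_snd.contMDiffAt

theorem contDiffAt_mulInChart :
    ContDiffAt ℝ ∞ (mulInChart E G) (identityCoord E G, identityCoord E G) := by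
  refine contMDiffAt_iff_contDiffAt.1 (ContMDiffAt.comp (I' := 𝓘(ℝ, E)) _
    (g := extChartAt 𝓘(ℝ, E) (1 : G)) ?_
    (contMDiffAt_extChartAt_one_symm_fst.mul contMDiffAt_extChartAt_one_symm_snd))
  rw [extChartAt_symm_identityCoord, mul_one]
  exact contMDiffAt_extChartAt

theorem contDiffAt_conjInChart_uncurry :
    ContDiffAt ℝ ∞
      (fun z : E × E => conjInChart E ((extChartAt 𝓘(ℝ, E) (1 : G)).symm z.1) z.2)
      (identityCoord E G, identityCoord E G) := by
  refine contMDiffAt_iff_contDiffAt.1 (ContMDiffAt.comp (I' := 𝓘(ℝ, E)) _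
    (g := extChartAt 𝓘(ℝ, E) (1 : G)) ?_
    ((contMDiffAt_extChartAt_one_symm_fst.mul contMDiffAt_extChartAt_one_symm_snd).mul
      contMDiffAt_extChartAt_one_symm_fst.inv))
  rw [extChartAt_symm_identityCoord, mul_one, mul_inv_cancel]
  exact contMDiffAt_extChartAt

variable (E G) in
/-- The adjoint map in the preferred chart at the identity. -/
noncomputable def adInChart (x : E) : E →L[ℝ] E :=
  adModel E ((extChartAt 𝓘(ℝ, E) (1 : G)).symm x)

variable (E G) in
/-- The adjoint action of the Lie algebra, `adDeriv u v = [u, v]`. -/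
noncomputable def adDeriv : E →L[ℝ] E →L[ℝ] E :=
  fderiv ℝ (adInChart E G) (identityCoord E G)

theorem contDiffAt_adInChart : ContDiffAt ℝ 1 (adInChart E G) (identityCoord E G) :=
  ContDiffAt.fderiv (g := fun _ => identityCoord E G) (n := ∞)
    (f := fun x => conjInChart E ((extChartAt 𝓘(ℝ, E) (1 : G)).symm x))
    contDiffAt_conjInChart_uncurry contDiffAt_const (by norm_cast)

theorem hasFDerivAt_adInChart :
    HasFDerivAt (adInChart E G) (adDeriv E G) (identityCoord E G) :=
  (contDiffAt_adInChart.differentiableAt one_ne_zero).hasFDerivAt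

theorem adDeriv_apply_self (u : E) : adDeriv E G u u = 0 := by
  have hfst : Tendsto (fun z : E × E => (extChartAt 𝓘(ℝ, E) (1 : G)).symm z.1)
      (𝓝 (identityCoord E G, identityCoord E G)) (𝓝 1) :=
    tendsto_extChartAt_one_symm.comp continuousAt_fst
  have hsnd : Tendsto (fun z : E × E => (extChartAt 𝓘(ℝ, E) (1 : G)).symm z.2)
      (𝓝 (identityCoord E G, identityCoord E G)) (𝓝 1) :=
    tendsto_extChartAt_one_symm.comp continuousAt_snd
  have := topologicalGroup_of_lieGroup 𝓘(ℝ, E) ∞ (G := G)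
  refine fderiv_fderiv_conj_apply_self (m := mulInChart E G)
    (contDiffAt_mulInChart.of_le (by norm_cast))
    (contDiffAt_conjInChart_uncurry.of_le (by norm_cast))
    (Eventually.of_forall fun x => conjInChart_identityCoord _) ?_ ?_ ?_ u
  · filter_upwards [eventually_extChartAt_extChartAt_one_symm] with y hy
    simpa only [conjInChart, extChartAt_symm_identityCoord, one_mul, inv_one, mul_one] using hy
  · filter_upwards [eventually_extChartAt_extChartAt_one_symm] with y hy
    simpa only [mulInChart, extChartAt_symm_identityCoord, mul_one] using hy
  · have h := (hfst.mul hsnd).mul hfst.inv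
    simp only [mul_one, inv_one] at h
    filter_upwards [h.eventually (eventually_extChartAt_symm_extChartAt_one (E := E))] with z hz
    simp only [mulInChart, conjInChart, hz, inv_mul_cancel_right]

/-- Regularity at `1` spreads to every `g` through `Ad_h = Ad_g ∘ Ad_{g⁻¹ h}`. -/
theorem contMDiff_adModel : ContMDiff 𝓘(ℝ, E) 𝓘(ℝ, E →L[ℝ] E) 1 (adModel E : G → E →L[ℝ] E) := by
  have h1 : ContMDiffAt 𝓘(ℝ, E) 𝓘(ℝ, E →L[ℝ] E) 1 (adModel E : G → E →L[ℝ] E) 1 := by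
    have h2 : ContMDiffAt 𝓘(ℝ, E) 𝓘(ℝ, E →L[ℝ] E) 1
        (adInChart E G ∘ extChartAt 𝓘(ℝ, E) (1 : G)) 1 := by
      exact ContMDiffAt.comp (I' := 𝓘(ℝ, E)) (1 : G)
        (contMDiffAt_iff_contDiffAt.2 contDiffAt_adInChart) contMDiffAt_extChartAt
    refine h2.congr_of_eventuallyEq ?_
    filter_upwards [eventually_extChartAt_symm_extChartAt_one (E := E) (G := G)] with g hg
    simp only [Function.comp_apply, adInChart, hg]
  intro g
  have h3 : (adModel E : G → E →L[ℝ] E) = fun h =>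
      ContinuousLinearMap.compL ℝ E E E (adModel E g) (adModel E (g⁻¹ * h)) := by
    ext1 h
    rw [ContinuousLinearMap.compL_apply, ← adModel_mul, mul_inv_cancel_left]
  rw [h3]
  refine (ContinuousLinearMap.contMDiff _).contMDiffAt.comp (I' := 𝓘(ℝ, E →L[ℝ] E)) g ?_
  refine ContMDiffAt.comp (I' := 𝓘(ℝ, E)) (g := (adModel E : G → E →L[ℝ] E)) g ?_
    ((contMDiff_mul_left (I := 𝓘(ℝ, E)) (n := ∞) (a := g⁻¹)).contMDiffAt.of_le
      (by norm_cast))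
  rw [inv_mul_cancel]
  exact h1

theorem hasDerivAt_extChartAt_inv_mul {γ : ℝ → G} {t : ℝ} {u : GroupLieAlgebra 𝓘(ℝ, E) G}
    (hγ : HasMFDerivAt 𝓘(ℝ, ℝ) 𝓘(ℝ, E) γ t
      ((1 : ℝ →L[ℝ] ℝ).smulRight (mulInvariantVectorField u (γ t)))) :
    HasDerivAt (fun s => extChartAt 𝓘(ℝ, E) (1 : G) ((γ t)⁻¹ * γ s)) (u : E) t := by
  set g := γ t with hg
  set κ : G → E := fun h => extChartAt 𝓘(ℝ, E) (1 : G) (g⁻¹ * h) with hκ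
  have hκd : MDifferentiableAt 𝓘(ℝ, E) 𝓘(ℝ, E) κ g := by
    have : ContMDiffAt 𝓘(ℝ, E) 𝓘(ℝ, E) ∞ κ g := by
      refine ContMDiffAt.comp (I' := 𝓘(ℝ, E)) (g := extChartAt 𝓘(ℝ, E) (1 : G)) g ?_
        (contMDiff_mul_left (I := 𝓘(ℝ, E)) (n := ∞) (a := g⁻¹)).contMDiffAt
      rw [inv_mul_cancel]
      exact contMDiffAt_extChartAt
    exact this.mdifferentiableAt (by simp)
  have hLd : MDifferentiableAt 𝓘(ℝ, E) 𝓘(ℝ, E) (fun h : G => g * h) 1 :=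
    (contMDiff_mul_left (I := 𝓘(ℝ, E)) (n := ∞) (a := g)).contMDiffAt.mdifferentiableAt (by simp)
  have hval : (mfderiv 𝓘(ℝ, E) 𝓘(ℝ, E) κ g : E →L[ℝ] E)
      (mulInvariantVectorField u g : E) = (u : E) := by
    have h1 : κ ∘ (fun h : G => g * h) = extChartAt 𝓘(ℝ, E) (1 : G) := by
      ext h; simp [hκ]
    have h2 := mfderiv_comp (I'' := 𝓘(ℝ, E)) (1 : G) (g := κ) (f := fun h : G => g * h)
      (by rw [mul_one]; exact hκd) hLd
    rw [h1, mfderiv_extChartAt_self] at h2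
    -- The tangent space depends on the base point, so passing from `g * 1` to `g` needs a
    -- generalized equality.
    have h3 : ∀ g' : G, g' = g → (mfderiv 𝓘(ℝ, E) 𝓘(ℝ, E) κ g' : E →L[ℝ] E)
        = (mfderiv 𝓘(ℝ, E) 𝓘(ℝ, E) κ g : E →L[ℝ] E) := by
      rintro _ rfl; rfl
    have h4 : (u : E) = (mfderiv 𝓘(ℝ, E) 𝓘(ℝ, E) κ (g * 1) : E →L[ℝ] E)
        (mulInvariantVectorField u g : E) := congrArg (fun f : E →L[ℝ] E => f u) h2
    rw [h3 _ (mul_one g)] at h4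
    exact h4.symm
  have h5 : HasMFDerivAt 𝓘(ℝ, ℝ) 𝓘(ℝ, E) (κ ∘ γ) t _ := HasMFDerivAt.comp t hκd.hasMFDerivAt hγ
  have h6 : ∀ (w : E) (A : E →L[ℝ] E),
      HasFDerivAt (κ ∘ γ) (A ∘L (1 : ℝ →L[ℝ] ℝ).smulRight w) t → HasDerivAt (κ ∘ γ) (A w) t :=
    fun w A h => h.hasDerivAt.congr_deriv (by simp)
  exact hval ▸ h6 (mulInvariantVectorField u g) (mfderiv 𝓘(ℝ, E) 𝓘(ℝ, E) κ g)
    (hasMFDerivAt_iff_hasFDerivAt.1 h5)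

/-- Factor `Ad_{γ s} = Ad_{γ t} ∘ Ad_{(γ t)⁻¹ γ s}`: the second factor passes through the identity
at `s = t` with velocity `u`. -/
theorem hasDerivAt_adModel {γ : ℝ → G} {t : ℝ} {u : GroupLieAlgebra 𝓘(ℝ, E) G}
    (hγ : HasMFDerivAt 𝓘(ℝ, ℝ) 𝓘(ℝ, E) γ t
      ((1 : ℝ →L[ℝ] ℝ).smulRight (mulInvariantVectorField u (γ t)))) :
    HasDerivAt (fun s => adModel E (γ s)) (adModel E (γ t) ∘L adDeriv E G (u : E)) t := by
  have := topologicalGroup_of_lieGroup 𝓘(ℝ, E) ∞ (G := G)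
  have h1 := hasDerivAt_extChartAt_inv_mul hγ
  have h2 : HasDerivAt
      (fun s => adInChart E G (extChartAt 𝓘(ℝ, E) (1 : G) ((γ t)⁻¹ * γ s)))
      (adDeriv E G (u : E)) t := by
    refine HasFDerivAt.comp_hasDerivAt (l := adInChart E G) t ?_ h1
    rw [inv_mul_cancel]
    exact hasFDerivAt_adInChart
  have h3 := (ContinuousLinearMap.compL ℝ E E E (adModel E (γ t))).hasFDerivAt.comp_hasDerivAt t h2
  refine h3.congr_of_eventuallyEq ?_
  have h4 : Tendsto (fun s => (γ t)⁻¹ * γ s) (𝓝 t) (𝓝 1) := by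
    have := (tendsto_const_nhds (x := (γ t)⁻¹)).mul hγ.continuousAt.tendsto
    rwa [inv_mul_cancel] at this
  filter_upwards [h4.eventually (eventually_extChartAt_symm_extChartAt_one (E := E))] with s hs
  simp only [Function.comp_apply, adInChart, hs, ContinuousLinearMap.compL_apply]
  rw [← adModel_mul, mul_inv_cancel_left]

/-- In a chart a `C¹` map is locally Lipschitz, and Lipschitz maps preserve absolute continuity. -/
theorem eventually_absolutelyContinuousOnInterval_comp {F : Type*} [NormedAddCommGroup F]
    [NormedSpace ℝ F] {f : G → F} (hf : ContMDiff 𝓘(ℝ, E) 𝓘(ℝ, F) 1 f) {J : Set ℝ}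
    (hJ : J.OrdConnected) {γ : ℝ → G} (hγ : IsAbsolutelyContinuousCurve E J γ) {x : ℝ}
    (hx : x ∈ J) : ∀ᶠ y in 𝓝[J] x, AbsolutelyContinuousOnInterval (fun t => f (γ t)) x y := by
  set ψ := chartAt E (γ x)
  have h1 : ContDiffAt ℝ 1 (f ∘ ψ.symm) (ψ (γ x)) := by
    refine contMDiffAt_iff_contDiffAt.1 (hf.contMDiffAt.comp _ ?_)
    exact (contMDiffOn_chart_symm (I := 𝓘(ℝ, E))).contMDiffAt
      (ψ.open_target.mem_nhds (mem_chart_target E (γ x)))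
  obtain ⟨K, U, hU, hK⟩ := h1.exists_lipschitzOnWith
  have h2 : ∀ᶠ z in 𝓝[J] x, γ z ∈ ψ.source ∧ ψ (γ z) ∈ U := by
    have h3 := hγ.1 x hx
    have h4 := (ψ.continuousAt (mem_chart_source E (γ x))).tendsto.comp h3
    exact (h3.eventually (ψ.open_source.mem_nhds (mem_chart_source E (γ x)))).and
      (h4.eventually hU)
  rw [eventually_nhdsWithin_iff, Metric.eventually_nhds_iff_ball] at h2
  obtain ⟨δ, hδ, hball⟩ := h2
  filter_upwards [self_mem_nhdsWithin, mem_nhdsWithin_of_mem_nhds (Metric.ball_mem_nhds x hδ)]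
    with y hyJ hyB
  have hsJ : uIcc x y ⊆ J := hJ.uIcc_subset hx hyJ
  have hsB : uIcc x y ⊆ Metric.ball x δ :=
    (convex_ball x δ).ordConnected.uIcc_subset (Metric.mem_ball_self hδ) hyB
  have hmem : ∀ z ∈ uIcc x y, γ z ∈ ψ.source ∧ ψ (γ z) ∈ U := fun z hz =>
    hball z (hsB hz) (hsJ hz)
  have hac : AbsolutelyContinuousOnInterval (fun t => ψ (γ t)) x y := by
    -- The point `y` may lie on either side of `x`.
    have h5 := hγ.2 (min x y) (max x y) min_le_max hsJ (γ x) fun z hz => (hmem z hz).1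
    exact h5.mono (by rw [uIcc_of_le min_le_max]; rfl)
  have h6 := hK.comp_absolutelyContinuousOnInterval hac fun z hz => (hmem z hz).2
  refine h6.congr_of_eqOn fun z hz => ?_
  simp only [Function.comp_apply, ψ.left_inv (hmem z hz).1]

end Adjoint

end FinslerLie

theorem corollary1p4
    {E : Type*} [NormedAddCommGroup E] [NormedSpace ℝ E] [FiniteDimensional ℝ E]
    {G : Type*} [TopologicalSpace G] [ChartedSpace E G] [Group G] [LieGroup 𝓘(ℝ, E) ∞ G]
    (N : Seminorm ℝ (GroupLieAlgebra 𝓘(ℝ, E) G))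
    (hN : FinslerLie.IsNorm N) (hpoly : FinslerLie.IsPolyhedral N) :
    ∃ L : ℝ, 0 < L ∧
      ∀ (J : Set ℝ) (γ : ℝ → G) (u : ℝ → GroupLieAlgebra 𝓘(ℝ, E) G),
        J.OrdConnected → FinslerLie.IsNormalCurve N J γ u →
        0 < FinslerLie.length N J u → FinslerLie.length N J u < ENNReal.ofReal L →
        FinslerLie.TakesValuesInFace N J u := by
  obtain ⟨L, hL, h⟩ := FinslerLie.exists_forall_takesValuesInFace (V := E) (N := N) hN hpoly
    (FinslerLie.adDeriv_apply_self (E := E) (G := G))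
  refine ⟨L, hL, fun J γ u hJ hγ hpos hlt => ?_⟩
  obtain ⟨l, hl⟩ := hγ.normal
  set l' : E →L[ℝ] ℝ := LinearMap.toContinuousLinearMap (l : E →ₗ[ℝ] ℝ)
  -- The Lie algebra is definitionally `E`, so the vector-space result applies to `η t = l ∘ Ad_{γ
  -- t}`.
  refine h J (fun t => l' ∘L FinslerLie.adModel E (γ t)) u hJ hγ.isControl.1 (fun x hx => ?_) ?_ ?_
    hpos hlt
  · refine FinslerLie.eventually_absolutelyContinuousOnInterval_comp
      (f := fun g => l' ∘L FinslerLie.adModel E g) ?_ hJ hγ.absolutelyContinuous hx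
    exact (ContinuousLinearMap.compL ℝ E E ℝ l').contMDiff.comp FinslerLie.contMDiff_adModel
  · filter_upwards [hγ.isControl.2] with t ht
    have := (ContinuousLinearMap.compL ℝ E E ℝ l').hasFDerivAt.comp_hasDerivAt t
      (FinslerLie.hasDerivAt_adModel ht)
    exact this
  · filter_upwards [hl] with t ht
    have : ((l' ∘L FinslerLie.adModel E (γ t) : E →L[ℝ] ℝ) : E →ₗ[ℝ] ℝ)
        = l ∘ₗ (FinslerLie.Ad E (γ t)).toLinearMap := by
      rw [FinslerLie.Ad_eq_adModel]
      rfl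
    rw [this]
    exact ht
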